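/- Throughout, $\mathbb N=\{0,1,2,\dots\}$. For non-decreasing $f,g\colon\mathbb N\to\mathbb N$ write $f\preceq g$ if there is an integer $c>0$ with $f(n)\le c\,g(cn+c)+c$ for all $n$, and $f\sim g$ if $f\preceq g$ and $g\preceq f$. If $\Gamma$ is a connected locally finite graph with path-metric $\mathrm{dist}$ and $U$ is a non-empty set of vertices, then $\mathsf{Growth}(U)$ is the $\sim$-class of $n\mapsto|\{x\in U:\mathrm{dist}(A,x)\le n\}|$, where $A\subseteq U$ is any finite non-empty set (the class does not depend on $A$), and $\mathsf{Growth}(\Gamma)=\mathsf{Growth}(V(\Gamma))$. A finitely generated group has polynomial growth of degree $d$ if the growth rate of its Cayley graph with respect to some (equivalently, any) finite generating set is the $\sim$-class of $n\mapsto n^d$. Given a finite set $X_0$ of vertices of $\Gamma$ (the initial fire) and finite sets $W_1,W_2,\dots$ of vertices, let $X_n$, for $n\ge1$, be the set of all vertices that are joined to a vertex of $X_{n-1}$ by a path of length at most $1$ containing no vertex of $(W_1\cup\dots\cup W_n)\setminus X_{n-1}$. For an integer $m\ge 0$, the graph $\Gamma$ has the polynomial retaining property of degree $m$ if there is an integer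 $K>0$ such that for every finite set $X_0$ of vertices there are sets $W_1,W_2,\dots$ of vertices with $|W_n|\le Kn^m$ for all $n\ge1$ such that $U=V(\Gamma)\setminus\bigcup_{n\ge0}X_n$ is non-empty and $\mathsf{Growth}(U)=\mathsf{Growth}(\Gamma)$. A group $G$ splits over a subgroup $C$ if either $G=A*_CB$ is an amalgamated product with $C$ a proper subgroup of both $A$ and $B$, or $G=A*_C$ is an HNN-extension (with no assumption on $C$ or on the isomorphism of $C$ onto the other associated subgroup of $A$). A finitely generated subgroup $C$ of a finitely generated group $G$ is quasi-isometrically embedded if for some (equivalently, any) finite generating set $S'$ of $G$ containing a finite generating set $T$ of $C$ there is a constant $c>0$ with $\frac1c\,\mathrm{dist}_T(x,y)-c\le\mathrm{dist}_{S'}(x,y)\le c\,\mathrm{dist}_T(x,y)+c$ for all $x,y\in C$, where $\mathrm{dist}_T$ and $\mathrm{dist}_{S'}$ are the word metrics. **Theorem.** Let $G$ be a finitely generated group that splits over a subgroup $C$. Suppose that $C$ is finitely generated, has polynomial growth of degree $d$ for an integer $d>0$, and is quasi-isometrically embedded in $G$. Then for every finite generating set $S$ of $G$, the Cayley graph of $G$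 with respect to $S$ has the polynomial retaining property of degree $d-1$. -/

import Mathlib

/-! ### Growth rates -/

/-- `f ≼ g`: there is an integer `c > 0` with `f n ≤ c * g (c * n + c) + c` for every `n`. -/
def GrowthLE (f g : ℕ → ℕ) : Prop :=
  ∃ c : ℕ, 0 < c ∧ ∀ n, f n ≤ c * g (c * n + c) + c

/-- `f ∼ g`: equivalent growth rate. -/
def GrowthEquiv (f g : ℕ → ℕ) : Prop :=
  GrowthLE f g ∧ GrowthLE g f

/-- The growth function `n ↦ |B_U(A, n)|` of a set `U` of vertices of a connected graph `Γ`, with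
respect to a finite non-empty set `A ⊆ U`. The metric on `U` is the restriction of the path-metric
of `Γ`. (Balls are finite when `Γ` is locally finite.) -/
noncomputable def growthFun {V : Type*} (Γ : SimpleGraph V) (U : Set V) (A : Finset V) (n : ℕ) :
    ℕ :=
  {x : V | x ∈ U ∧ ∃ a ∈ A, Γ.dist a x ≤ n}.ncard

/-- `Growth(U) = Growth(Γ)` for a non-empty set `U` of vertices of `Γ`. The growth rate does not
depend on the finite non-empty sets with respect to which the growth functions are taken. -/
def SameGrowth {V : Type*} (Γ : SimpleGraph V) (U : Set V) : Prop :=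
  ∃ A B : Finset V, A.Nonempty ∧ B.Nonempty ∧ (A : Set V) ⊆ U ∧
    GrowthEquiv (growthFun Γ U A) (growthFun Γ Set.univ B)

/-! ### The fire retaining game -/

/-- The vertices that the firefighter has chosen up to time `n`, i.e. `W 1 ∪ ⋯ ∪ W n`. -/
def chosenUpTo {V : Type*} (W : ℕ → Finset V) (n : ℕ) : Set V :=
  {v | ∃ i, 1 ≤ i ∧ i ≤ n ∧ v ∈ W i}

/-- The set `X_n` of vertices on fire at time `n`, with initial fire `X₀` of reach `r` and sets
`W 1, W 2, …` of vertices to protect (`W 0` plays no role). -/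
def onFire {V : Type*} (Γ : SimpleGraph V) (r : ℕ) (W : ℕ → Finset V) (X₀ : Finset V) :
    ℕ → Set V
  | 0 => (X₀ : Set V)
  | n + 1 => {v | ∃ x ∈ onFire Γ r W X₀ n, ∃ p : Γ.Walk x v, p.length ≤ r ∧
      ∀ u ∈ p.support, u ∉ chosenUpTo W (n + 1) \ onFire Γ r W X₀ n}

/-- `W 1, W 2, …` is an `{f_n}`-strategy: `W n` has at most `f n` elements for every `n ≥ 1`. -/
def IsStrategy {V : Type*} (f : ℕ → ℕ) (W : ℕ → Finset V) : Prop :=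
  ∀ n, 1 ≤ n → (W n).card ≤ f n

/-- `W` is a retaining `{f_n}`-strategy for the initial fire `X₀` of reach `r`. -/
def IsRetainingStrategy {V : Type*} (Γ : SimpleGraph V) (f : ℕ → ℕ) (r : ℕ) (X₀ : Finset V)
    (W : ℕ → Finset V) : Prop :=
  IsStrategy f W ∧ SameGrowth Γ (⋃ n, onFire Γ r W X₀ n)ᶜ

/-- The `({f_n}, r)`-retaining property of a connected graph. -/
def HasRetainingProperty {V : Type*} (Γ : SimpleGraph V) (f : ℕ → ℕ) (r : ℕ) : Prop :=
  ∀ X₀ : Finset V, ∃ W : ℕ → Finset V, IsRetainingStrategy Γ f r X₀ W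

/-- The polynomial retaining property of degree `d` of a connected graph. -/
def HasPolynomialRetainingProperty {V : Type*} (Γ : SimpleGraph V) (d : ℕ) : Prop :=
  ∃ K : ℕ, 0 < K ∧ HasRetainingProperty Γ (fun n => K * n ^ d) 1

/-! ### Finitely generated groups -/

/-- `S` is a finite generating set of the group `G`. -/
def IsFiniteGeneratingSet {G : Type*} [Group G] (S : Set G) : Prop :=
  S.Finite ∧ Subgroup.closure S = ⊤

/-- The group `G` has polynomial growth of degree `d`: for some (equivalently, any) finite
generating set, the growth rate of the Cayley graph is that of `n ↦ n ^ d`. -/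
def HasPolynomialGrowth (G : Type*) [Group G] (d : ℕ) : Prop :=
  ∃ S : Set G, IsFiniteGeneratingSet S ∧
    GrowthEquiv (growthFun (SimpleGraph.mulCayley S) Set.univ {1}) (fun n => n ^ d)

/-- `φ` is a `c`-quasi-isometric embedding for the path-metrics of the graphs `Γ` and `Δ`. -/
def IsQuasiIsometricEmbedding {V W : Type*} (Γ : SimpleGraph V) (Δ : SimpleGraph W) (φ : V → W)
    (c : ℝ) : Prop :=
  ∀ x y : V, 1 / c * (Γ.dist x y : ℝ) - c ≤ (Δ.dist (φ x) (φ y) : ℝ) ∧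
    (Δ.dist (φ x) (φ y) : ℝ) ≤ c * (Γ.dist x y : ℝ) + c

/-- The subgroup `C` is quasi-isometrically embedded in `G`: for some (equivalently, any) finite
generating set `S` of `G` containing a finite generating set `T` of `C`, the inclusion of the Cayley
graph of `C` with respect to `T` in that of `G` with respect to `S` is a quasi-isometric
embedding. -/
def IsQuasiIsometricallyEmbedded {G : Type*} [Group G] (C : Subgroup G) : Prop :=
  ∃ (T : Set C) (S : Set G), IsFiniteGeneratingSet T ∧ IsFiniteGeneratingSet S ∧
    Subtype.val '' T ⊆ S ∧
    ∃ c : ℝ, 0 < c ∧ IsQuasiIsometricEmbedding (SimpleGraph.mulCayley T)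
      (SimpleGraph.mulCayley S) (Subtype.val : C → G) c

/-! ### Splittings -/

/-- `G = A *_C B` with `C` a proper subgroup of `A` and of `B`: the canonical homomorphism from the
amalgamated product to `G` is an isomorphism. -/
def IsProperAmalgam {G : Type*} [Group G] (A B C : Subgroup G) : Prop :=
  ∃ h : ∀ i : Bool, C < cond i A B,
    Function.Bijective
      (Monoid.PushoutI.lift (φ := fun i : Bool => Subgroup.inclusion (h i).le)
        (fun i : Bool => (cond i A B).subtype) C.subtype (fun _ => rfl))

/-- `G` is an HNN-extension `A *_C`: there are an isomorphism `φ` from `C ≤ A` onto a subgroup `D`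
of `A` and a stable letter `t` with `t c t⁻¹ = φ c` on `C`, such that the canonical homomorphism
from the abstract HNN-extension to `G` is an isomorphism. -/
def IsHNNExtensionOver {G : Type*} [Group G] (A C : Subgroup G) : Prop :=
  C ≤ A ∧ ∃ (D : Subgroup A) (φ : C.subgroupOf A ≃* D) (t : G)
    (h : ∀ c : C.subgroupOf A, t * A.subtype (c : A) = A.subtype (φ c : A) * t),
    Function.Bijective (HNNExtension.lift A.subtype t h)

/-- The group `G` splits over its subgroup `C`. -/
def SplitsOver {G : Type*} [Group G] (C : Subgroup G) : Prop :=
  (∃ A B : Subgroup G, IsProperAmalgam A B C) ∨ ∃ A : Subgroup G, IsHNNExtensionOver A C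

/-! ### Word metrics -/

namespace SimpleGraph

/-! The splitting provides a half-space `H` of `G` whose boundary lies in finitely many cosets `C *
f`. A left translate of `H` serves as the prison for the fire, and its boundary as the wall to be
built.

Let the initial fire lie in the ball of radius `R` about `1`. Some `x ∈ H` is so far from the
boundary that the translate `x⁻¹ H` contains this ball and its wall `Z` is at distance more than
`2R` from `1`. The fire moves at speed one, so it is contained if the part of `Z` within `n + R` of
`1` is protected by turn `n`. That part is empty while `n ≤ R`. For `n > R` it lies in a ball of
radius less than `2n` and, as `C` has degree `d` growth also in the metric of `G`, has at most `K *
n ^ d` points with `K` independent of the fire. A budget of order `n ^ (d - 1)` per turn pays for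
this (`exists_isStrategy_subset_chosenUpTo`).

The saved set contains the complement of the prison. A left translation, or inversion followed by
one, maps `H` injectively into its complement and changes lengths by a bounded amount, so the saved
set has the growth of `G` (`sameGrowth_of_injOn`).

The half-space consists of words with a prescribed beginning. Normal forms in amalgams and Britton's
lemma in HNN-extensions make this beginning well defined. Right multiplication by a generator
changes it only next to `C`. -/

lemma Walk.dist_map_le {V W : Type*} {Γ : SimpleGraph V} {Δ : SimpleGraph W} (hΔ : Δ.Connected)
    (f : V → W) (k : ℕ) (hf : ∀ u v, Γ.Adj u v → Δ.dist (f u) (f v) ≤ k) {u v : V}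
    (p : Γ.Walk u v) : Δ.dist (f u) (f v) ≤ k * p.length := by
  induction p with
  | nil => simp
  | @cons u v w h q ih =>
    have := hΔ.dist_triangle (u := f u) (v := f v) (w := f w)
    have := hf u v h
    simp only [Walk.length_cons, mul_add, mul_one]
    omega

lemma Connected.dist_map_le {V W : Type*} {Γ : SimpleGraph V} {Δ : SimpleGraph W}
    (hΓ : Γ.Connected) (hΔ : Δ.Connected) (f : V → W) (k : ℕ)
    (hf : ∀ u v, Γ.Adj u v → Δ.dist (f u) (f v) ≤ k) (u v : V) :
    Δ.dist (f u) (f v) ≤ k * Γ.dist u v := by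
  obtain ⟨p, hp⟩ := hΓ.exists_walk_length_eq_dist u v
  exact hp ▸ p.dist_map_le hΔ f k hf

lemma Connected.exists_adj_dist_eq {V : Type*} {Γ : SimpleGraph V} (hΓ : Γ.Connected) {a x : V}
    {n : ℕ} (h : Γ.dist a x = n + 1) : ∃ y, Γ.Adj y x ∧ Γ.dist a y ≤ n := by
  obtain ⟨p, hp⟩ := hΓ.exists_walk_length_eq_dist x a
  rw [dist_comm, h] at hp
  cases p with
  | nil => simp at hp
  | cons hadj q =>
    refine ⟨_, hadj.symm, ?_⟩
    rw [dist_comm]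
    refine (dist_le q).trans ?_
    simp only [Walk.length_cons] at hp
    omega

lemma Connected.dist_le_succ_of_adj {V : Type*} {Γ : SimpleGraph V} (hΓ : Γ.Connected) {a x y : V}
    (h : Γ.Adj x y) : Γ.dist a y ≤ Γ.dist a x + 1 := by
  have := hΓ.dist_triangle (u := a) (v := x) (w := y)
  rwa [dist_eq_one_iff_adj.2 h] at this

variable {G : Type*} [Group G]

lemma mulCayley_reachable_mul_left {S : Set G} (g : G) {x y : G}
    (h : (mulCayley S).Reachable x y) : (mulCayley S).Reachable (g * x) (g * y) :=
  h.map (⟨(g * ·), fun h => mulCayley_adj_mul_iff_right.2 h⟩ : mulCayley S →g mulCayley S)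

lemma mulCayley_connected {S : Set G} (hS : Subgroup.closure S = ⊤) :
    (mulCayley S).Connected := by
  have key : ∀ g : G, (mulCayley S).Reachable 1 g := fun g => by
    induction (hS ▸ Subgroup.mem_top g : g ∈ Subgroup.closure S) using
      Subgroup.closure_induction with
    | mem s hs =>
      by_cases h : (1 : G) = s
      · rw [← h]
      · exact Adj.reachable ((mulCayley_adj S 1 s).2 ⟨h, Or.inl (by simpa using hs)⟩)
    | one => rfl
    | mul x y _ _ hx hy =>
      exact hx.trans (by simpa using mulCayley_reachable_mul_left x hy)
    | inv x _ hx => exact (by simpa using mulCayley_reachable_mul_left x⁻¹ hx :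
        (mulCayley S).Reachable x⁻¹ 1).symm
  exact { preconnected := fun x y => (key x).symm.trans (key y), nonempty := ⟨1⟩ }

variable {S : Set G}

lemma mulCayley_dist_mul_left (hS : Subgroup.closure S = ⊤) (g x y : G) :
    (mulCayley S).dist (g * x) (g * y) = (mulCayley S).dist x y := by
  have hc := mulCayley_connected hS
  have key : ∀ g x y : G, (mulCayley S).dist (g * x) (g * y) ≤ (mulCayley S).dist x y :=
    fun g x y => by
      simpa using hc.dist_map_le hc (g * ·) 1 (fun u v h =>
        (dist_eq_one_iff_adj.2 (mulCayley_adj_mul_iff_right.2 h)).le) x y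
  refine (key g x y).antisymm ?_
  simpa using key g⁻¹ (g * x) (g * y)

lemma mulCayley_dist_one_mul_le (hS : Subgroup.closure S = ⊤) (x y : G) :
    (mulCayley S).dist 1 (x * y) ≤ (mulCayley S).dist 1 x + (mulCayley S).dist 1 y := by
  have := (mulCayley_connected hS).dist_triangle (u := 1) (v := x) (w := x * y)
  have h := mulCayley_dist_mul_left hS x 1 y
  rw [mul_one] at h
  omega

lemma mulCayley_dist_eq (hS : Subgroup.closure S = ⊤) (x y : G) :
    (mulCayley S).dist x y = (mulCayley S).dist 1 (x⁻¹ * y) := by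
  simpa using (mulCayley_dist_mul_left hS x⁻¹ x y).symm

lemma mulCayley_dist_one_inv (hS : Subgroup.closure S = ⊤) (x : G) :
    (mulCayley S).dist 1 x⁻¹ = (mulCayley S).dist 1 x := by
  rw [dist_comm, mulCayley_dist_eq hS]
  simp

lemma mulCayley_finite_ball (hf : S.Finite) (hS : Subgroup.closure S = ⊤) (a : G) (n : ℕ) :
    {x | (mulCayley S).dist a x ≤ n}.Finite := by
  have hc := mulCayley_connected hS
  induction n with
  | zero =>
    refine (Set.finite_singleton a).subset fun x hx => ?_
    simpa [hc.dist_eq_zero_iff, eq_comm] using hx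
  | succ n ih =>
    refine (ih.union (Set.Finite.image2 (fun y s => y * s) ih (hf.union hf.inv))).subset ?_
    intro x hx
    rcases Nat.lt_or_ge n ((mulCayley S).dist a x) with h | h
    · obtain ⟨y, hy, hd⟩ := hc.exists_adj_dist_eq (le_antisymm hx h)
      refine Or.inr ⟨y, hd, y⁻¹ * x, ?_, by simp⟩
      rcases ((mulCayley_adj S y x).1 hy).2 with h | h
      · exact Or.inl h
      · exact Or.inr (by simpa using h)
    · exact Or.inl h

lemma exists_mulCayley_dist_le_mul {S' : Set G} (hf : S.Finite) (hS : Subgroup.closure S = ⊤)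
    (hS' : Subgroup.closure S' = ⊤) :
    ∃ k : ℕ, ∀ x y, (mulCayley S').dist x y ≤ k * (mulCayley S).dist x y := by
  obtain ⟨k, hk⟩ := (hf.image fun s => (mulCayley S').dist 1 s).bddAbove
  refine ⟨k, (mulCayley_connected hS).dist_map_le (mulCayley_connected hS') id k ?_⟩
  intro u v h
  simp only [id]
  rcases ((mulCayley_adj S u v).1 h).2 with h | h
  · rw [mulCayley_dist_eq hS']
    exact hk ⟨_, h, rfl⟩
  · rw [dist_comm, mulCayley_dist_eq hS']
    exact hk ⟨_, h, rfl⟩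

end SimpleGraph

open SimpleGraph

/-- The lower quasi-isometry bound and the changes of generating sets are linear, so a ball of
radius `n` of `G` meets `C` inside a ball of `C` of radius linear in `n`. -/
lemma IsQuasiIsometricallyEmbedded.exists_ncard_ball_le {G : Type*} [Group G] {C : Subgroup G}
    (hqi : IsQuasiIsometricallyEmbedded C) {d : ℕ} (hgrowth : HasPolynomialGrowth C d)
    {S : Set G} (hS : IsFiniteGeneratingSet S) :
    ∃ c : ℕ, ∀ n, {x : C | (mulCayley S).dist 1 (x : G) ≤ n}.Finite ∧
      {x : C | (mulCayley S).dist 1 (x : G) ≤ n}.ncard ≤ c * (n + 1) ^ d := by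
  obtain ⟨T, S', hT, hS', -, c, hc, hqi⟩ := hqi
  obtain ⟨T', hT', ⟨e, he, hle⟩, -⟩ := hgrowth
  obtain ⟨k, hk⟩ := exists_mulCayley_dist_le_mul hS.1 hS.2 hS'.2
  obtain ⟨l, hl⟩ := exists_mulCayley_dist_le_mul hT.1 hT.2 hT'.2
  obtain ⟨q, hq⟩ := exists_nat_ge c
  have hdist : ∀ x : C, (mulCayley T').dist 1 x ≤
      l * (q * (k * (mulCayley S).dist 1 (x : G) + q)) := fun x => by
    refine (hl 1 x).trans (Nat.mul_le_mul_left l ?_)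
    have h1 := (hqi 1 x).1
    have h2 : ((mulCayley S').dist 1 (x : G) : ℝ) ≤ k * (mulCayley S).dist 1 (x : G) := by
      exact_mod_cast hk 1 (x : G)
    have h3 : ((mulCayley T).dist 1 x : ℝ) ≤
        c * ((mulCayley S').dist 1 (x : G) + c) := by
      rw [OneMemClass.coe_one] at h1
      rw [← div_le_iff₀' hc]
      calc _ = 1 / c * ((mulCayley T).dist 1 x : ℝ) := by ring
        _ ≤ _ := by linarith
    have h4 : c * (((mulCayley S').dist 1 (x : G) : ℝ) + c) ≤
        q * (k * (mulCayley S).dist 1 (x : G) + q) := by gcongr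
    exact_mod_cast h3.trans h4
  set m := l * (q * (k + q)) with hm
  have hsub : ∀ n, {x : C | (mulCayley S).dist 1 (x : G) ≤ n} ⊆
      {x : C | (mulCayley T').dist 1 x ≤ m * (n + 1)} := fun n x hx => by
    refine (hdist x).trans ?_
    have hx : (mulCayley S).dist 1 (x : G) ≤ n := hx
    calc _ ≤ l * (q * (k * (n + 1) + q * (n + 1))) := by gcongr <;> nlinarith
      _ = _ := by rw [hm]; ring
  refine ⟨e * (e * m + e) ^ d + e, fun n => ?_⟩
  have hfin := mulCayley_finite_ball hT'.1 hT'.2 1 (m * (n + 1))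
  refine ⟨hfin.subset (hsub n), (Set.ncard_le_ncard (hsub n) hfin).trans ?_⟩
  have := hle (m * (n + 1))
  simp only [growthFun, Set.mem_univ, Finset.mem_singleton, exists_eq_left, true_and] at this
  refine this.trans ?_
  have h1 : e * (m * (n + 1)) + e ≤ (e * m + e) * (n + 1) := by nlinarith
  calc _ ≤ e * ((e * m + e) * (n + 1)) ^ d + e * (n + 1) ^ d := by
        gcongr
        exact Nat.le_mul_of_pos_right _ (by positivity)
    _ = _ := by rw [mul_pow]; ring

/-! ### Protecting an increasing sequence of finite sets -/

lemma exists_injOn_lt_ncard {V : Type*} {D : Set V} (hD : D.Finite) :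
    ∃ e : V → ℕ, Set.InjOn e D ∧ ∀ z ∈ D, e z < D.ncard := by
  classical
  obtain ⟨D, rfl⟩ := hD.exists_finset_coe
  refine ⟨fun z => if h : z ∈ D then (D.equivFin ⟨z, h⟩ : ℕ) else 0, ?_, ?_⟩
  · intro x hx y hy hxy
    have hx : x ∈ D := hx
    have hy : y ∈ D := hy
    simpa [hx, hy, Fin.val_inj] using hxy
  · intro z hz
    have hz : z ∈ D := hz
    simp [hz]

/-- The points are numbered shell by shell: those of `N (m + 1) \ N m` receive consecutive numbers
from `(N m).ncard` on. -/
lemma exists_injOn_iUnion_lt_ncard {V : Type*} {N : ℕ → Set V} (hmono : Monotone N)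
    (hfin : ∀ n, (N n).Finite) (h0 : N 0 = ∅) :
    ∃ e : V → ℕ, Set.InjOn e (⋃ n, N n) ∧ ∀ n, ∀ z ∈ N n, e z < (N n).ncard := by
  classical
  choose e he hlt using fun m => exists_injOn_lt_ncard ((hfin (m + 1)).sdiff (t := N m))
  have hex : ∀ z ∈ ⋃ n, N n, ∃ m, z ∈ N (m + 1) \ N m ∧ ∀ n, z ∈ N n → m + 1 ≤ n := by
    intro z hz
    have hz : ∃ n, z ∈ N n := by simpa using hz
    have hpos : Nat.find hz ≠ 0 := fun h => by simpa [h, h0] using Nat.find_spec hz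
    obtain ⟨m, hm⟩ := Nat.exists_eq_succ_of_ne_zero hpos
    refine ⟨m, ⟨?_, ?_⟩, fun n hn => ?_⟩
    · simpa [hm] using Nat.find_spec hz
    · exact Nat.find_min hz (by omega)
    · exact hm.symm.le.trans (Nat.find_min' hz hn)
  choose! l hl hle using hex
  have hbound : ∀ z ∈ ⋃ n, N n, (N (l z)).ncard + e (l z) z < (N (l z + 1)).ncard := by
    intro z hz
    have h1 := hlt _ z (hl z hz)
    have h2 := Set.ncard_sdiff_add_ncard_of_subset (hmono (Nat.le_succ (l z))) (hfin _)
    simp only [Nat.succ_eq_add_one] at h2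
    omega
  have hlow : ∀ x ∈ ⋃ n, N n, ∀ y ∈ ⋃ n, N n, l x < l y →
      (N (l x)).ncard + e (l x) x < (N (l y)).ncard + e (l y) y := by
    intro x hx y hy h
    have := hbound x hx
    have := Set.ncard_le_ncard (hmono (Nat.succ_le_of_lt h)) (hfin _)
    simp only [Nat.succ_eq_add_one] at this
    omega
  refine ⟨fun z => (N (l z)).ncard + e (l z) z, ?_, ?_⟩
  · intro x hx y hy hxy
    simp only at hxy
    rcases lt_trichotomy (l x) (l y) with h | h | h
    · have := hlow x hx y hy h
      omega
    · rw [h] at hxy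
      exact he (l y) (h ▸ hl x hx) (hl y hy) (by omega)
    · have := hlow y hy x hx h
      omega
  · intro n z hz
    have hzu := Set.mem_iUnion.2 ⟨n, hz⟩
    exact (hbound z hzu).trans_le (Set.ncard_le_ncard (hmono (hle z hzu n hz)) (hfin _))

/-- Only the cumulative budget `T` matters: protecting the points in the order of their numbers, as
many per turn as allowed, covers `N n` by turn `n`. -/
lemma exists_isStrategy_subset_chosenUpTo {V : Type*} {N : ℕ → Set V} (hmono : Monotone N)
    (hfin : ∀ n, (N n).Finite) (h0 : N 0 = ∅) (k : ℕ → ℕ)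
    (hcard : ∀ n, (N n).ncard ≤ ∑ i ∈ Finset.range n, k (i + 1)) :
    ∃ W : ℕ → Finset V, IsStrategy k W ∧ ∀ n, N n ⊆ chosenUpTo W n := by
  classical
  obtain ⟨e, he, hlt⟩ := exists_injOn_iUnion_lt_ncard hmono hfin h0
  set T : ℕ → ℕ := fun n => ∑ i ∈ Finset.range n, k (i + 1) with hT
  -- The truncated subtraction makes `D 0` empty.
  let D : ℕ → Set V := fun n => {z | z ∈ ⋃ n, N n ∧ T (n - 1) ≤ e z ∧ e z < T n}
  have hmaps : ∀ n, Set.MapsTo e (D n) (Finset.Ico (T (n - 1)) (T n)) := fun n z hz => by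
    simpa using hz.2
  have hinj : ∀ n, Set.InjOn e (D n) := fun n => he.mono fun z hz => hz.1
  have hDfin : ∀ n, (D n).Finite := fun n =>
    Set.Finite.of_injOn (hmaps n) (hinj n) (Finset.finite_toSet _)
  refine ⟨fun n => (hDfin n).toFinset, fun n hn => ?_, fun n z hz => ?_⟩
  · obtain ⟨n, rfl⟩ := Nat.exists_eq_succ_of_ne_zero (Nat.one_le_iff_ne_zero.1 hn)
    have := Finset.card_le_card_of_injOn (s := (hDfin (n + 1)).toFinset)
      (t := Finset.Ico (T n) (T (n + 1))) e (by simpa using hmaps (n + 1))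
      (by simpa using hinj (n + 1))
    simpa [hT, Finset.sum_range_succ] using this
  · have hex : ∃ i, e z < T i := ⟨n, (hlt n z hz).trans_le (hcard n)⟩
    have hpos : Nat.find hex ≠ 0 := fun h => by simpa [h, hT] using Nat.find_spec hex
    refine ⟨Nat.find hex, by omega, Nat.find_min' hex ((hlt n z hz).trans_le (hcard n)), ?_⟩
    simp only [Set.Finite.mem_toFinset]
    exact ⟨Set.mem_iUnion.2 ⟨n, hz⟩, not_lt.1 (Nat.find_min hex (by omega)), Nat.find_spec hex⟩

lemma pow_le_sum_range_mul_pow (d n : ℕ) :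
    n ^ (d + 1) ≤ ∑ i ∈ Finset.range n, (d + 1) * (i + 1) ^ d := by
  induction n with
  | zero => simp
  | succ n ih =>
    rw [Finset.sum_range_succ]
    have h : (n + 1) ^ (d + 1) ≤ n ^ (d + 1) + (d + 1) * (n + 1) ^ d := by
      clear ih
      induction d with
      | zero => simp
      | succ d ih =>
        have h2 : n ^ (d + 1) ≤ (n + 1) ^ (d + 1) := Nat.pow_le_pow_left (Nat.le_succ n) _
        calc (n + 1) ^ (d + 1 + 1) = (n + 1) ^ (d + 1) * n + (n + 1) ^ (d + 1) := by ring
          _ ≤ (n ^ (d + 1) + (d + 1) * (n + 1) ^ d) * n + (n + 1) ^ (d + 1) := by gcongr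
          _ ≤ n ^ (d + 1 + 1) + (d + 1) * ((n + 1) ^ d * (n + 1)) + (n + 1) ^ (d + 1) := by
            rw [add_mul, ← pow_succ, mul_assoc]
            gcongr
            omega
          _ = _ := by ring
    omega

/-! ### Growth of half-spaces -/

/-- A ball splits into its parts in `Hᶜ` and in `H`. The first lies in `U`, and `φ` injects the
second into `U` within a slightly larger ball, so the ball has at most twice as many points as the
larger ball of `U`. The base point `φ x` is chosen to lie in `U`. -/
lemma sameGrowth_of_injOn {G : Type*} [Group G] {S : Set G} (hS : IsFiniteGeneratingSet S)
    {U H : Set G} (hU : Hᶜ ⊆ U) {φ : G → G} (hφ : Set.InjOn φ H) (hφH : ∀ v ∈ H, φ v ∉ H)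
    (hH : H.Nonempty) {k : ℕ}
    (hk : ∀ v, (mulCayley S).dist 1 (φ v) ≤ (mulCayley S).dist 1 v + k) :
    SameGrowth (mulCayley S) U := by
  have hc := mulCayley_connected hS.2
  obtain ⟨x, hx⟩ := hH
  have hfin : ∀ n, {v | (mulCayley S).dist (φ x) v ≤ n}.Finite :=
    mulCayley_finite_ball hS.1 hS.2 (φ x)
  have hgr : ∀ V n, growthFun (mulCayley S) V {φ x} n =
      {v | v ∈ V ∧ (mulCayley S).dist (φ x) v ≤ n}.ncard := fun V n => by simp [growthFun]
  have hUf : ∀ n, {v | v ∈ U ∧ (mulCayley S).dist (φ x) v ≤ n}.Finite :=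
    fun n => (hfin n).subset fun v hv => hv.2
  refine ⟨{φ x}, {φ x}, by simp, by simp, by simpa using hU (hφH x hx), ⟨1, one_pos, fun n => ?_⟩,
    ⟨2 + 2 * (mulCayley S).dist 1 (φ x) + k, by omega, fun n => ?_⟩⟩
  · rw [hgr, hgr]
    have : {v | v ∈ U ∧ (mulCayley S).dist (φ x) v ≤ n}.ncard ≤
        {v | v ∈ Set.univ ∧ (mulCayley S).dist (φ x) v ≤ 1 * n + 1}.ncard :=
      Set.ncard_le_ncard (fun v hv => ⟨trivial, hv.2.trans (by omega)⟩)
        ((hfin (1 * n + 1)).subset fun v hv => hv.2)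
    omega
  · set m := 2 * (mulCayley S).dist 1 (φ x) + k with hm
    rw [hgr, hgr]
    set B := {v | v ∈ U ∧ (mulCayley S).dist (φ x) v ≤
      (2 + 2 * (mulCayley S).dist 1 (φ x) + k) * n + (2 + 2 * (mulCayley S).dist 1 (φ x) + k)}
    have hmB : ∀ v, v ∈ U → (mulCayley S).dist (φ x) v ≤ n + m → v ∈ B := fun v hv h =>
      ⟨hv, h.trans (by nlinarith)⟩
    have h1 : {v | v ∈ Set.univ ∧ (mulCayley S).dist (φ x) v ≤ n} ⊆
        {v | v ∈ Hᶜ ∧ (mulCayley S).dist (φ x) v ≤ n} ∪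
          {v | v ∈ H ∧ (mulCayley S).dist (φ x) v ≤ n} := by
      rintro v ⟨-, hv⟩
      by_cases h : v ∈ H
      · exact Or.inr ⟨h, hv⟩
      · exact Or.inl ⟨h, hv⟩
    have h2 : {v | v ∈ Hᶜ ∧ (mulCayley S).dist (φ x) v ≤ n}.ncard ≤ B.ncard :=
      Set.ncard_le_ncard (fun v hv => hmB v (hU hv.1) (hv.2.trans (by omega))) (hUf _)
    have h3 : {v | v ∈ H ∧ (mulCayley S).dist (φ x) v ≤ n}.ncard ≤ B.ncard := by
      refine Set.ncard_le_ncard_of_injOn φ (fun v hv => hmB _ (hU (hφH v hv.1)) ?_)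
        (hφ.mono fun v hv => hv.1) (hUf _)
      have e1 := hc.dist_triangle (u := φ x) (v := 1) (w := φ v)
      have e2 := hc.dist_triangle (u := 1) (v := φ x) (w := v)
      have e3 := hk v
      have e4 := hv.2
      rw [dist_comm (u := φ x) (v := 1)] at e1
      omega
    have h4 := (Set.ncard_le_ncard h1 ((hfin n).subset (by
      rintro v (hv | hv) <;> exact hv.2))).trans (Set.ncard_union_le _ _)
    nlinarith

/-! ### Retaining a fire on one side of a wall -/

lemma exists_finite_boundary_subset {G : Type*} [Group G] {S : Set G} (hS : S.Finite)
    {C : Subgroup G} {H : Set G}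
    (hcob : ∀ s ∈ S, ∃ F : Set G, F.Finite ∧
      ∀ h, ¬(h ∈ H ↔ h * s ∈ H) → ∃ c ∈ C, ∃ f ∈ F, h = c * f) :
    ∃ F : Set G, F.Finite ∧ ∀ u v, (mulCayley S).Adj u v → u ∈ H → v ∉ H →
      ∃ c ∈ C, ∃ f ∈ F, u = c * f := by
  choose! F hF hFC using hcob
  refine ⟨⋃ s ∈ S, (F s ∪ (· * s) '' F s),
    hS.biUnion fun s hs => (hF s hs).union ((hF s hs).image _), fun u v h hu hv => ?_⟩
  rw [mulCayley_adj'] at h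
  obtain ⟨-, s, hs, rfl | rfl⟩ := h
  · obtain ⟨c, hc, f, hf, h⟩ := hFC s hs u (by tauto)
    exact ⟨c, hc, f, Set.mem_biUnion hs (Or.inl hf), h⟩
  · obtain ⟨c, hc, f, hf, h⟩ := hFC s hs v (by tauto)
    exact ⟨c, hc, f * s, Set.mem_biUnion hs (Or.inr ⟨f, hf, rfl⟩), by rw [h, mul_assoc]⟩

/-- Fixing one point `v₀` of the ball on a translated coset `x⁻¹ C f`, the map `v ↦ f v₀⁻¹ v f⁻¹`
sends the other points injectively to elements of `C` of length at most `2n + 2r`. The bound does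
not depend on `x`, which later varies with the fire. -/
lemma ncard_ball_inter_cosets_le {G : Type*} [Group G] {S : Set G}
    (hS : IsFiniteGeneratingSet S) {C : Subgroup G} {c d : ℕ}
    (hc : ∀ n, {x : C | (mulCayley S).dist 1 (x : G) ≤ n}.Finite ∧
      {x : C | (mulCayley S).dist 1 (x : G) ≤ n}.ncard ≤ c * (n + 1) ^ d)
    {F : Finset G} {r : ℕ} (hF : ∀ f ∈ F, (mulCayley S).dist 1 f ≤ r) (x : G) (n : ℕ) :
    {v | (mulCayley S).dist 1 v ≤ n ∧ ∃ a ∈ C, ∃ f ∈ F, x * v = a * f}.ncard ≤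
      F.card * (c * (2 * n + 2 * r + 1) ^ d) := by
  classical
  have hfin := mulCayley_finite_ball hS.1 hS.2 1 n
  have hone : ∀ f ∈ F, {v | (mulCayley S).dist 1 v ≤ n ∧ ∃ a ∈ C, x * v = a * f}.ncard ≤
      c * (2 * n + 2 * r + 1) ^ d := by
    intro f hf
    rcases Set.eq_empty_or_nonempty {v | (mulCayley S).dist 1 v ≤ n ∧ ∃ a ∈ C, x * v = a * f}
      with h | ⟨v₀, hv₀, a₀, ha₀, hxv₀⟩
    · simp [h]
    · refine le_trans ?_ (hc (2 * n + 2 * r)).2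
      rw [← Set.ncard_image_of_injective _ (Subtype.val_injective (p := (· ∈ C)))]
      refine Set.ncard_le_ncard_of_injOn (fun v => f * (v₀⁻¹ * (v * f⁻¹))) ?_ ?_
        ((hc _).1.image _)
      · rintro v ⟨hv, a, ha, hxv⟩
        have : f * (v₀⁻¹ * (v * f⁻¹)) = a₀⁻¹ * a := by
          rw [eq_inv_mul_iff_mul_eq, ← mul_assoc, ← hxv₀, eq_mul_inv_of_mul_eq hxv.symm]
          group
        refine ⟨⟨_, this ▸ C.mul_mem (C.inv_mem ha₀) ha⟩, ?_, rfl⟩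
        have h1 := mulCayley_dist_one_mul_le hS.2 f (v₀⁻¹ * (v * f⁻¹))
        have h2 := mulCayley_dist_one_mul_le hS.2 v₀⁻¹ (v * f⁻¹)
        have h3 := mulCayley_dist_one_mul_le hS.2 v f⁻¹
        rw [mulCayley_dist_one_inv hS.2] at h2 h3
        have h4 := hF f hf
        simp only [Set.mem_ofPred_eq]
        omega
      · intro u _ v _ huv
        simpa using huv
  have hsub : {v | (mulCayley S).dist 1 v ≤ n ∧ ∃ a ∈ C, ∃ f ∈ F, x * v = a * f} ⊆
      ⋃ f ∈ F, {v | (mulCayley S).dist 1 v ≤ n ∧ ∃ a ∈ C, x * v = a * f} := by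
    rintro v ⟨hv, a, ha, f, hf, h⟩
    exact Set.mem_biUnion (x := f) hf ⟨hv, a, ha, h⟩
  refine (Set.ncard_le_ncard hsub (hfin.subset ?_)).trans ((F.set_ncard_biUnion_le _).trans ?_)
  · intro v hv
    simp only [Set.mem_iUnion] at hv
    obtain ⟨f, hf, h⟩ := hv
    exact h.1
  · simpa using Finset.sum_le_card_nsmul F _ _ hone

/-- To leave `H` the fire must first burn a vertex of `Z`, but any vertex of `Z` that it could reach
at time `n` is already protected. -/
lemma onFire_subset_of_boundary_protected {V : Type*} {Γ : SimpleGraph V} (hΓ : Γ.Connected)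
    {H Z : Set V} (hZ : ∀ u v, Γ.Adj u v → u ∈ H → v ∉ H → u ∈ Z) (o : V) {R : ℕ}
    {X₀ : Finset V} (hX₀ : ∀ v ∈ X₀, v ∈ H ∧ v ∉ Z ∧ Γ.dist o v ≤ R) {W : ℕ → Finset V}
    (hW : ∀ n, {v | v ∈ Z ∧ Γ.dist o v ≤ n + R} ⊆ chosenUpTo W n) (n : ℕ) :
    ∀ v ∈ onFire Γ 1 W X₀ n, v ∈ H ∧ v ∉ Z ∧ Γ.dist o v ≤ n + R := by
  induction n with
  | zero => simpa [onFire] using hX₀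
  | succ n ih =>
    rintro v ⟨u, hu, p, hp, hsupp⟩
    by_cases hv : v ∈ onFire Γ 1 W X₀ n
    · obtain ⟨h1, h2, h3⟩ := ih v hv
      exact ⟨h1, h2, by omega⟩
    obtain ⟨h1, h2, h3⟩ := ih u hu
    have hadj : Γ.Adj u v := by
      refine Walk.adj_of_length_eq_one (p := p) (le_antisymm hp
        (Nat.one_le_iff_ne_zero.2 fun h => ?_))
      exact hv (Walk.eq_of_length_eq_zero h ▸ hu)
    have hd : Γ.dist o v ≤ n + 1 + R := by
      have := hΓ.dist_le_succ_of_adj (a := o) hadj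
      omega
    refine ⟨by_contra fun h => h2 (hZ u v hadj h1 h), fun h => ?_, hd⟩
    exact hsupp v p.end_mem_support ⟨hW (n + 1) ⟨h, hd⟩, hv⟩

theorem hasPolynomialRetainingProperty_of_halfspace {G : Type*} [Group G] {S : Set G}
    (hS : IsFiniteGeneratingSet S) {C : Subgroup G} {H : Set G}
    (hcob : ∀ s ∈ S, ∃ F : Set G, F.Finite ∧
      ∀ h, ¬(h ∈ H ↔ h * s ∈ H) → ∃ c ∈ C, ∃ f ∈ F, h = c * f)
    {φ : G → G} (hφ : Set.InjOn φ H) (hφH : ∀ v ∈ H, φ v ∉ H) {k : ℕ}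
    (hk : ∀ v, (mulCayley S).dist 1 (φ v) ≤ (mulCayley S).dist 1 v + k)
    (hfar : ∀ F : Set G, F.Finite → ∃ x ∈ H, ∀ c ∈ C, ∀ f ∈ F, x ≠ c * f)
    {c d : ℕ} (hc : ∀ n, {x : C | (mulCayley S).dist 1 (x : G) ≤ n}.Finite ∧
      {x : C | (mulCayley S).dist 1 (x : G) ≤ n}.ncard ≤ c * (n + 1) ^ (d + 1)) :
    HasPolynomialRetainingProperty (mulCayley S) d := by
  classical
  have hconn := mulCayley_connected hS.2
  obtain ⟨F, hF, hbd⟩ := exists_finite_boundary_subset hS.1 hcob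
  obtain ⟨F, rfl⟩ := hF.exists_finset_coe
  obtain ⟨r, hr⟩ := ((F : Set G).toFinite.image fun f => (mulCayley S).dist 1 f).bddAbove
  replace hr : ∀ f ∈ F, (mulCayley S).dist 1 f ≤ r := fun f hf => hr ⟨f, hf, rfl⟩
  -- For `n > R` one has `2(n + R) + 2r + 1 ≤ (2r + 5)n`; thus `K` can be fixed before `X₀`.
  set K := F.card * (c * (2 * r + 5) ^ (d + 1)) with hK
  refine ⟨K * (d + 1) + 1, by omega, fun X₀ => ?_⟩
  obtain ⟨R, hR⟩ := ((X₀ : Set G).toFinite.image fun f => (mulCayley S).dist 1 f).bddAbove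
  replace hR : ∀ v ∈ X₀, (mulCayley S).dist 1 v ≤ R := fun v hv => hR ⟨v, hv, rfl⟩
  -- If `x * v = a * f`, then `x = a * (f * v⁻¹)`; avoiding the ball of radius `2R + r` therefore
  -- forces `v` to have length more than `2R`.
  obtain ⟨x, hx, hxfar⟩ := hfar _ (mulCayley_finite_ball hS.1 hS.2 1 (2 * R + r))
  let H' : Set G := {v | x * v ∈ H}
  let Z : Set G := {v | ∃ a ∈ C, ∃ f ∈ F, x * v = a * f}
  have hZ : ∀ u v, (mulCayley S).Adj u v → u ∈ H' → v ∉ H' → u ∈ Z := fun u v h hu hv =>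
    hbd (x * u) (x * v) (mulCayley_adj_mul_iff_right.2 h) hu hv
  have hZfar : ∀ v ∈ Z, 2 * R < (mulCayley S).dist 1 v := by
    rintro v ⟨a, ha, f, hf, h⟩
    by_contra! hv
    refine hxfar a ha (f * v⁻¹) ?_ (by rw [← mul_assoc, ← h, mul_inv_cancel_right])
    have h1 := mulCayley_dist_one_mul_le hS.2 f v⁻¹
    rw [mulCayley_dist_one_inv hS.2] at h1
    have := hr f hf
    simp only [Set.mem_ofPred_eq]
    omega
  -- A geodesic from `1` cannot leave `H'` before it meets `Z`, which is too far away.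
  have hball : ∀ n, n ≤ R → ∀ v, (mulCayley S).dist 1 v ≤ n → v ∈ H' := by
    intro n
    induction n with
    | zero =>
      intro _ v hv
      have : 1 = v := by simpa [hconn.dist_eq_zero_iff] using hv
      simpa [H', ← this] using hx
    | succ n ih =>
      intro hn v hv
      rcases Nat.lt_or_ge n ((mulCayley S).dist 1 v) with h | h
      · obtain ⟨y, hy, hd⟩ := hconn.exists_adj_dist_eq (le_antisymm hv h)
        by_contra hvH
        have := hZfar y (hZ y v hy (ih (by omega) y hd) hvH)
        omega
      · exact ih (by omega) v h
  have hX₀ : ∀ v ∈ X₀, v ∈ H' ∧ v ∉ Z ∧ (mulCayley S).dist 1 v ≤ R := fun v hv =>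
    ⟨hball R le_rfl v (hR v hv), fun h => by have := hZfar v h; have := hR v hv; omega, hR v hv⟩
  let N : ℕ → Set G := fun n => {v | v ∈ Z ∧ (mulCayley S).dist 1 v ≤ n + R}
  have hN : ∀ n, n ≤ R → N n = ∅ := fun n hn => Set.eq_empty_of_forall_notMem fun v hv => by
    have := hZfar v hv.1
    have := hv.2
    omega
  have hcard : ∀ n, (N n).ncard ≤
      ∑ i ∈ Finset.range n, (K * (d + 1) + 1) * (i + 1) ^ d := by
    intro n
    rcases Nat.lt_or_ge R n with h | h
    · calc (N n).ncard ≤ F.card * (c * (2 * (n + R) + 2 * r + 1) ^ (d + 1)) := by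
            refine le_trans (Set.ncard_le_ncard (fun v (hv : v ∈ N n) => And.intro hv.2 hv.1)
              ((mulCayley_finite_ball hS.1 hS.2 1 (n + R)).subset fun v hv => hv.1))
              (ncard_ball_inter_cosets_le hS hc hr x (n + R))
        _ ≤ F.card * (c * ((2 * r + 5) * n) ^ (d + 1)) := by
            gcongr
            nlinarith
        _ = K * n ^ (d + 1) := by rw [hK, mul_pow]; ring
        _ ≤ K * ∑ i ∈ Finset.range n, (d + 1) * (i + 1) ^ d := by
            gcongr
            exact pow_le_sum_range_mul_pow d n
        _ ≤ _ := by
            rw [Finset.mul_sum]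
            refine Finset.sum_le_sum fun i _ => ?_
            rw [← mul_assoc]
            gcongr
            omega
    · simp [hN n h]
  obtain ⟨W, hW, hNW⟩ := exists_isStrategy_subset_chosenUpTo (N := N)
    (fun m n hmn v hv => ⟨hv.1, hv.2.trans (by omega)⟩)
    (fun n => (mulCayley_finite_ball hS.1 hS.2 1 (n + R)).subset fun v hv => hv.2)
    (hN 0 (Nat.zero_le R)) (fun n => (K * (d + 1) + 1) * n ^ d) hcard
  refine ⟨W, hW, sameGrowth_of_injOn hS (H := H') (φ := fun v => x⁻¹ * φ (x * v)) ?_ ?_ ?_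
    ⟨1, by simpa [H'] using hx⟩ (k := k + 2 * (mulCayley S).dist 1 x) fun v => ?_⟩
  · refine Set.compl_subset_compl.2 (Set.iUnion_subset fun n v hv => ?_)
    exact (onFire_subset_of_boundary_protected hconn hZ 1 hX₀ hNW n v hv).1
  · intro u hu v hv huv
    exact mul_left_cancel (hφ hu hv (mul_left_cancel huv))
  · intro v hv
    simpa [H'] using hφH _ hv
  · have h1 := mulCayley_dist_one_mul_le hS.2 x⁻¹ (φ (x * v))
    have h2 := mulCayley_dist_one_mul_le hS.2 x v
    have h3 := hk (x * v)
    rw [mulCayley_dist_one_inv hS.2] at h1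
    omega

/-! ### Almost invariant sets -/

/-- A change of membership along `x * y` occurs along `x` or along `y`, so the property passes to
products and inverses. `M` may be infinite, as `F` may depend on `s`; this allows whole vertex
groups as generators. -/
lemma exists_finite_coboundary_subset {G : Type*} [Group G] {C : Subgroup G} {H M : Set G}
    (hM : Subgroup.closure M = ⊤)
    (h : ∀ s ∈ M, ∃ F : Set G, F.Finite ∧
      ∀ h, ¬(h ∈ H ↔ h * s ∈ H) → ∃ c ∈ C, ∃ f ∈ F, h = c * f) (s : G) :
    ∃ F : Set G, F.Finite ∧ ∀ h, ¬(h ∈ H ↔ h * s ∈ H) → ∃ c ∈ C, ∃ f ∈ F, h = c * f := by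
  induction (hM ▸ Subgroup.mem_top s : s ∈ Subgroup.closure M) using
    Subgroup.closure_induction with
  | mem s hs => exact h s hs
  | one => exact ⟨∅, Set.finite_empty, fun h hh => absurd (by simp) hh⟩
  | mul x y _ _ hx hy =>
    obtain ⟨F₁, hF₁, h₁⟩ := hx
    obtain ⟨F₂, hF₂, h₂⟩ := hy
    refine ⟨F₁ ∪ (· * x⁻¹) '' F₂, hF₁.union (hF₂.image _), fun h hh => ?_⟩
    by_cases h' : h ∈ H ↔ h * x ∈ H
    · rw [h', ← mul_assoc] at hh
      obtain ⟨c, hc, f, hf, e⟩ := h₂ _ hh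
      exact ⟨c, hc, f * x⁻¹, Or.inr ⟨f, hf, rfl⟩, by rw [← mul_assoc, ← e, mul_inv_cancel_right]⟩
    · obtain ⟨c, hc, f, hf, e⟩ := h₁ _ h'
      exact ⟨c, hc, f, Or.inl hf, e⟩
  | inv x _ hx =>
    obtain ⟨F, hF, h₁⟩ := hx
    refine ⟨(· * x) '' F, hF.image _, fun h hh => ?_⟩
    obtain ⟨c, hc, f, hf, e⟩ := h₁ (h * x⁻¹) (by rwa [inv_mul_cancel_right, iff_comm])
    exact ⟨c, hc, f * x, ⟨f, hf, rfl⟩, by rw [← mul_assoc, ← e, inv_mul_cancel_right]⟩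

/-- By pigeonhole, two of the points `g ^ n * y` would lie in the same coset `C * f`, which puts a
positive power of `g` in `C`. -/
lemma exists_mem_forall_ne_mul {G : Type*} [Group G] {C : Subgroup G} {H : Set G} {g y : G}
    (hg : ∀ n : ℕ, g ^ (n + 1) ∉ C) (hH : ∀ n : ℕ, g ^ n * y ∈ H) (F : Set G) (hF : F.Finite) :
    ∃ x ∈ H, ∀ c ∈ C, ∀ f ∈ F, x ≠ c * f := by
  by_contra! h
  choose c hc f hf he using fun n => h _ (hH n)
  obtain ⟨m, -, n, -, hmn, hfe⟩ := Set.infinite_univ.exists_lt_map_eq_of_mapsTo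
    (f := f) (t := F) (fun n _ => hf n) hF
  obtain ⟨l, rfl⟩ := Nat.exists_eq_add_of_lt hmn
  refine hg l ?_
  have h1 : g ^ (m + l + 1) * y = g ^ (l + 1) * (g ^ m * y) := by
    rw [← mul_assoc, ← pow_add]
    congr 2
    omega
  rw [he, he, ← hfe, ← mul_assoc, mul_left_inj] at h1
  rw [← mul_inv_eq_of_eq_mul h1]
  exact C.mul_mem (hc _) (C.inv_mem (hc _))

/-- A set `H` that is almost invariant over `C`, is not contained in finitely many cosets of `C`,
and is carried into its complement by a left translation, or by inversion followed by a left
translation. -/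
def HasHalfspaceOver {G : Type*} [Group G] (C : Subgroup G) : Prop :=
  ∃ (H : Set G) (φ : G → G) (a : G),
    (∀ s : G, ∃ F : Set G, F.Finite ∧
      ∀ h, ¬(h ∈ H ↔ h * s ∈ H) → ∃ c ∈ C, ∃ f ∈ F, h = c * f) ∧
    ((∀ x, φ x = a * x) ∨ ∀ x, φ x = a * x⁻¹) ∧ (∀ x ∈ H, φ x ∉ H) ∧
    ∀ F : Set G, F.Finite → ∃ x ∈ H, ∀ c ∈ C, ∀ f ∈ F, x ≠ c * f

/-! ### Amalgamated products -/

section Amalgam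

variable {G : Type*} [Group G] {M : Bool → Subgroup G} {C : Subgroup G}

/-- Products of non-empty words with letters alternately in `M true \ C` and `M false \ C`, and
first letter in `M i`. -/
inductive IsAlternatingProduct (M : Bool → Subgroup G) (C : Subgroup G) : Bool → G → Prop
  | single (i : Bool) (a : G) : a ∈ M i → a ∉ C → IsAlternatingProduct M C i a
  | cons (i : Bool) (a g : G) : a ∈ M i → a ∉ C → IsAlternatingProduct M C (!i) g →
      IsAlternatingProduct M C i (a * g)

/-- Right multiplication affects only the end of the word; the first letter can lose its type only
if the whole product falls into `C`. -/
lemma IsAlternatingProduct.mul_right (hC : ∀ i, C ≤ M i) {i : Bool} {g : G}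
    (hg : IsAlternatingProduct M C i g) {j : Bool} {b : G} (hb : b ∈ M j) :
    IsAlternatingProduct M C i (g * b) ∨ g * b ∈ C := by
  by_cases hbC : b ∈ C
  · left
    induction hg with
    | single i a ha haC =>
      exact .single i _ ((M i).mul_mem ha (hC i hbC)) (by rwa [C.mul_mem_cancel_right hbC])
    | cons i a g ha haC _ ih =>
      rw [mul_assoc]
      exact .cons i a _ ha haC ih
  · induction hg with
    | single i a ha haC =>
      by_cases hab : a * b ∈ C
      · exact Or.inr hab
      · rcases Bool.eq_or_eq_not j i with rfl | rfl
        · exact Or.inl (.single _ _ ((M _).mul_mem ha hb) hab)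
        · exact Or.inl (.cons _ _ _ ha haC (.single _ _ hb hbC))
    | cons i a g ha haC _ ih =>
      left
      rw [mul_assoc]
      rcases ih with h | h
      · exact .cons i a _ ha haC h
      · exact .single i _ ((M i).mul_mem ha (hC i h)) (by rwa [C.mul_mem_cancel_right h])

lemma IsAlternatingProduct.pow_mul {i : Bool} {a b : G} (ha : a ∈ M i) (haC : a ∉ C)
    (hb : b ∈ M (!i)) (hbC : b ∉ C) (n : ℕ) : IsAlternatingProduct M C i ((a * b) ^ n * a) ∧
      IsAlternatingProduct M C i ((a * b) ^ (n + 1)) := by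
  induction n with
  | zero => simpa using ⟨IsAlternatingProduct.single i a ha haC, .cons i a b ha haC (.single _ b hb hbC)⟩
  | succ n ih =>
    have h1 : (a * b) ^ (n + 1) * a = a * (b * ((a * b) ^ n * a)) := by
      rw [pow_succ', mul_assoc, mul_assoc]
    have h2 : (a * b) ^ (n + 1 + 1) = a * (b * (a * b) ^ (n + 1)) := by
      rw [pow_succ' _ (n + 1), mul_assoc]
    rw [h1, h2]
    exact ⟨.cons i a _ ha haC (.cons _ b _ hb hbC (by simpa using ih.1)),
      .cons i a _ ha haC (.cons _ b _ hb hbC (by simpa using ih.2))⟩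

lemma IsAlternatingProduct.exists_normalWord (hC : ∀ i, C ≤ M i)
    (d : Monoid.PushoutI.NormalWord.Transversal fun i => Subgroup.inclusion (hC i)) {i : Bool}
    {g : G} (hg : IsAlternatingProduct M C i g)
    {ψ : Monoid.PushoutI (fun i => Subgroup.inclusion (hC i)) →* G}
    (hψ : ∀ i (a : M i), ψ (Monoid.PushoutI.of i a) = a) :
    ∃ w : Monoid.PushoutI.NormalWord d, w.fstIdx = some i ∧ ψ w.prod = g := by
  have hnr : ∀ i (a : G) (ha : a ∈ M i), a ∉ C →
      (⟨a, ha⟩ : M i) ∉ (Subgroup.inclusion (hC i)).range := by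
    rintro i a ha haC ⟨c, hc⟩
    have hca : (c : G) = a := congrArg Subtype.val hc
    exact haC (hca ▸ c.2)
  induction hg with
  | single i a ha haC =>
    refine ⟨.cons ⟨a, ha⟩ .empty (by simp [Monoid.CoprodI.Word.fstIdx]) (hnr i a ha haC), ?_, ?_⟩
    · simp [Monoid.CoprodI.Word.fstIdx]
    · rw [Monoid.PushoutI.NormalWord.prod_cons, Monoid.PushoutI.NormalWord.prod_empty, mul_one, hψ]
  | cons i a g ha haC _ ih =>
    obtain ⟨w, hw, hwg⟩ := ih
    refine ⟨.cons ⟨a, ha⟩ w (by simp [hw]) (hnr i a ha haC), ?_, ?_⟩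
    · simp [Monoid.CoprodI.Word.fstIdx]
    · rw [Monoid.PushoutI.NormalWord.prod_cons, map_mul, hwg, hψ]

/-- The half-space consists of the products that begin in `M true \ C`. Left multiplication by `b ∈
M false \ C` makes them begin in `M false \ C`, and uniqueness of normal forms keeps the two kinds
apart. -/
theorem hasHalfspaceOver_of_bijective_pushoutI (hC : ∀ i, C < M i)
    {ψ : Monoid.PushoutI (fun i => Subgroup.inclusion (hC i).le) →* G}
    (hψ : ∀ i (a : M i), ψ (Monoid.PushoutI.of i a) = a)
    (hψC : ∀ c : C, ψ (Monoid.PushoutI.base _ c) = c) (hbij : Function.Bijective ψ) :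
    HasHalfspaceOver C := by
  obtain ⟨d⟩ := Monoid.PushoutI.NormalWord.transversal_nonempty
    (fun i => Subgroup.inclusion (hC i).le) fun i => Subgroup.inclusion_injective (hC i).le
  have hle := fun i => (hC i).le
  have hdisj : ∀ i j g, IsAlternatingProduct M C i g → IsAlternatingProduct M C j g → i = j := by
    intro i j g hi hj
    obtain ⟨w, hw, hwg⟩ := hi.exists_normalWord hle d hψ
    obtain ⟨w', hw', hwg'⟩ := hj.exists_normalWord hle d hψ
    obtain rfl := Monoid.PushoutI.NormalWord.prod_injective (hbij.1 (hwg.trans hwg'.symm))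
    exact Option.some_injective _ (hw.symm.trans hw')
  have hnotC : ∀ i g, IsAlternatingProduct M C i g → g ∉ C := by
    intro i g hi hg
    obtain ⟨w, hw, hwg⟩ := hi.exists_normalWord hle d hψ
    have h := Monoid.PushoutI.NormalWord.prod_injective (d := d)
      (a₂ := ⟨.empty, ⟨g, hg⟩, by simp [Monoid.CoprodI.Word.empty]⟩) (hbij.1 (hwg.trans
        (by simp [Monoid.PushoutI.NormalWord.prod, hψC])))
    rw [h] at hw
    simp [Monoid.CoprodI.Word.fstIdx, Monoid.CoprodI.Word.empty] at hw
  have hgen : Subgroup.closure (⋃ i, (M i : Set G)) = ⊤ := by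
    refine (Subgroup.eq_top_iff' _).2 fun g => ?_
    obtain ⟨p, rfl⟩ := hbij.2 g
    induction p using Monoid.PushoutI.induction_on with
    | of i g => simpa [hψ] using Subgroup.subset_closure (Set.mem_iUnion.2 ⟨i, g.2⟩)
    | base c => simpa [hψC] using Subgroup.subset_closure (Set.mem_iUnion.2 ⟨true, hle true c.2⟩)
    | mul x y hx hy => simpa only [map_mul] using mul_mem hx hy
  obtain ⟨-, a, ha, haC⟩ := SetLike.lt_iff_le_and_exists.1 (hC true)
  obtain ⟨-, b, hb, hbC⟩ := SetLike.lt_iff_le_and_exists.1 (hC false)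
  refine ⟨{g | IsAlternatingProduct M C true g}, (b * ·), b,
    exists_finite_coboundary_subset hgen fun s hs => ⟨{1, s⁻¹}, Set.toFinite _, fun h hh => ?_⟩,
    Or.inl fun _ => rfl, fun x hx hbx => ?_,
    exists_mem_forall_ne_mul (g := a * b) (y := a) (fun n => ?_) fun n => ?_⟩
  -- Membership changes only if `h * s ∈ C` or `h ∈ C`, which accounts for the cosets of `s⁻¹` and
  -- `1`.
  · obtain ⟨j, hj⟩ := Set.mem_iUnion.1 hs
    by_cases h1 : IsAlternatingProduct M C true h
    · rcases h1.mul_right hle hj with h2 | h2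
      · exact absurd (iff_of_true h1 h2) hh
      · exact ⟨_, h2, s⁻¹, by simp, by simp⟩
    · by_cases h2 : IsAlternatingProduct M C true (h * s)
      · rcases h2.mul_right hle ((M j).inv_mem hj) with h3 | h3
        · exact absurd (by simpa using h3) h1
        · exact ⟨h, by simpa using h3, 1, by simp, by simp⟩
      · exact absurd (iff_of_false h1 h2) hh
  · exact Bool.noConfusion (hdisj _ _ _ hbx (.cons false b x hb hbC hx))
  · exact hnotC _ _ (IsAlternatingProduct.pow_mul ha haC hb hbC n).2
  · exact (IsAlternatingProduct.pow_mul ha haC hb hbC n).1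

end Amalgam

/-! ### HNN extensions -/

section HNN

open HNNExtension HNNExtension.NormalWord

variable {X G : Type*} [Group X] [Group G] {A B : Subgroup X} {φ : A ≃* B} {f : X →* G} {t : G}

/-- Products of reduced words `t ^ u * x₁ * t ^ u₂ * x₂ * ⋯` that start with the letter
`t ^ u`. -/
inductive IsBrittonReduced (A B : Subgroup X) (f : X →* G) (t : G) : ℤˣ → G → Prop
  | single (u : ℤˣ) (x : X) : IsBrittonReduced A B f t u (t ^ (u : ℤ) * f x)
  | cons (u v : ℤˣ) (x : X) (g : G) : IsBrittonReduced A B f t v g →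
      (x ∈ toSubgroup A B u → u = v) → IsBrittonReduced A B f t u (t ^ (u : ℤ) * (f x * g))

lemma IsBrittonReduced.mul_right {u : ℤˣ} {g : G} (hg : IsBrittonReduced A B f t u g) (x : X) :
    IsBrittonReduced A B f t u (g * f x) := by
  induction hg with
  | single u y =>
    rw [mul_assoc, ← map_mul]
    exact .single u _
  | cons u v y g _ hy ih =>
    rw [mul_assoc, mul_assoc]
    exact .cons u v y _ ih hy

lemma exists_zpow_mul_map_mul_zpow_neg (ht : ∀ a : A, t * f a = f (φ a) * t) (u : ℤˣ) {x : X}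
    (hx : x ∈ toSubgroup A B u) :
    ∃ y ∈ toSubgroup A B (-u), t ^ (u : ℤ) * f x * t ^ ((-u : ℤˣ) : ℤ) = f y := by
  rcases Int.units_eq_one_or u with rfl | rfl
  · exact ⟨φ ⟨x, hx⟩, (φ ⟨x, hx⟩).2, by simpa using mul_inv_eq_of_eq_mul (ht ⟨x, hx⟩)⟩
  · refine ⟨φ.symm ⟨x, hx⟩, by simp, ?_⟩
    have := ht (φ.symm ⟨x, hx⟩)
    rw [MulEquiv.apply_symm_apply] at this
    simp [mul_assoc, ← this]

/-- A pinch at the end removes one stable letter, so the initial letter survives unless it is the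
only one. -/
lemma IsBrittonReduced.mul_zpow (ht : ∀ a : A, t * f a = f (φ a) * t) {u : ℤˣ} {g : G}
    (hg : IsBrittonReduced A B f t u g) (v : ℤˣ) :
    IsBrittonReduced A B f t u (g * t ^ (v : ℤ)) ∨
      ∃ y ∈ toSubgroup A B (-u), g * t ^ (v : ℤ) = f y := by
  induction hg with
  | single u x =>
    by_cases hx : x ∈ toSubgroup A B u → u = v
    · left
      simpa [mul_assoc] using IsBrittonReduced.cons (f := f) (t := t) u v x _ (.single v 1) hx
    · push Not at hx
      obtain rfl : v = -u := by
        rcases Int.units_eq_one_or u with rfl | rfl <;>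
          rcases Int.units_eq_one_or v with rfl | rfl <;> simp_all
      exact Or.inr (exists_zpow_mul_map_mul_zpow_neg ht u hx.1)
  | cons u w x g _ hx ih =>
    left
    rw [mul_assoc, mul_assoc]
    rcases ih with h | ⟨y, -, h⟩
    · exact .cons u w x _ h hx
    · rw [h, ← map_mul]
      exact .single u _

lemma isBrittonReduced_zpow_pow (u : ℤˣ) (n : ℕ) :
    IsBrittonReduced A B f t u ((t ^ (u : ℤ)) ^ (n + 1)) := by
  induction n with
  | zero => simpa using IsBrittonReduced.single (A := A) (B := B) (f := f) (t := t) u 1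
  | succ n ih =>
    rw [pow_succ']
    simpa using IsBrittonReduced.cons u u 1 _ ih fun _ => rfl

lemma IsBrittonReduced.exists_reducedWord (ht : ∀ a : A, t * f a = f (φ a) * t) {u : ℤˣ} {g : G}
    (hg : IsBrittonReduced A B f t u g) (x : X) :
    ∃ w : ReducedWord X A B, w.head = x ∧ w.toList.head?.map Prod.fst = some u ∧
      HNNExtension.lift f t ht (w.prod φ) = f x * g := by
  induction hg generalizing x with
  | single u y => exact ⟨⟨x, [(u, y)], by simp⟩, rfl, rfl, by simp [ReducedWord.prod]⟩
  | cons u v y g _ hy ih =>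
    obtain ⟨w, hw, hwv, hwg⟩ := ih y
    refine ⟨⟨x, (u, y) :: w.toList, List.isChain_cons.2 ⟨?_, w.chain⟩⟩, rfl, rfl, ?_⟩
    · intro z hz hyu
      rw [Option.mem_def.1 hz] at hwv
      rw [hy hyu]
      exact (Option.some_injective _ hwv).symm
    · simp only [ReducedWord.prod, hw] at hwg ⊢
      simpa [mul_assoc] using hwg

lemma IsBrittonReduced.eq_and_mem_of_mul_eq (ht : ∀ a : A, t * f a = f (φ a) * t)
    (hinj : Function.Injective (HNNExtension.lift f t ht)) {u v : ℤˣ} {g h : G}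
    (hg : IsBrittonReduced A B f t u g) (hh : IsBrittonReduced A B f t v h) {x y : X}
    (hxy : f x * g = f y * h) : u = v ∧ x⁻¹ * y ∈ toSubgroup A B (-u) := by
  obtain ⟨w, rfl, hwu, hwg⟩ := hg.exists_reducedWord ht x
  obtain ⟨w', rfl, hwv, hwh⟩ := hh.exists_reducedWord ht y
  obtain ⟨h1, h2⟩ := ReducedWord.map_fst_eq_and_of_prod_eq φ
    (hinj ((hwg.trans hxy).trans hwh.symm))
  rw [← List.head?_map] at hwu hwv
  exact ⟨Option.some_injective _ (by rw [← hwu, ← hwv, h1]), h2 u (by rwa [← List.head?_map])⟩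

lemma IsBrittonReduced.mul_ne (ht : ∀ a : A, t * f a = f (φ a) * t)
    (hinj : Function.Injective (HNNExtension.lift f t ht)) {u : ℤˣ} {g : G}
    (hg : IsBrittonReduced A B f t u g) (x y : X) : f x * g ≠ f y := by
  intro hxy
  obtain ⟨w, rfl, hwu, hwg⟩ := hg.exists_reducedWord ht x
  have := ReducedWord.toList_eq_nil_of_mem_of_range φ w
    ⟨y, hinj (by rw [hwg, hxy, HNNExtension.lift_of])⟩
  simp [this] at hwu

/-- By Britton's lemma, two reduced words for one element have the same first stable letter, and for
the letter `t⁻¹` their heads lie in the same left coset of `A`. This makes `H` recognisable from any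
reduced word. -/
theorem hasHalfspaceOver_of_bijective_hnnExtension_lift
    (ht : ∀ a : A, t * f a = f (φ a) * t)
    (hbij : Function.Bijective (HNNExtension.lift f t ht)) : HasHalfspaceOver (A.map f) := by
  set H : Set G := {h | ∃ a ∈ A, ∃ g, IsBrittonReduced A B f t (-1) g ∧ h = f a * g}
  have hgen : Subgroup.closure (insert t (Set.range f)) = ⊤ := by
    refine (Subgroup.eq_top_iff' _).2 fun g => ?_
    obtain ⟨p, rfl⟩ := hbij.2 g
    induction p using HNNExtension.induction_on with
    | of x => simpa using Subgroup.subset_closure (Set.mem_insert_of_mem t (Set.mem_range_self (f := f) x))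
    | t => simpa using Subgroup.subset_closure (Set.mem_insert t (Set.range f))
    | mul x y hx hy => simpa only [map_mul] using mul_mem hx hy
    | inv x hx => simpa only [map_inv] using inv_mem hx
  have hmulX : ∀ h ∈ H, ∀ x, h * f x ∈ H := by
    rintro _ ⟨a, ha, g, hg, rfl⟩ x
    exact ⟨a, ha, _, hg.mul_right x, by rw [mul_assoc]⟩
  have hmult : ∀ h ∈ H, ∀ v : ℤˣ, h * t ^ (v : ℤ) ∈ H ∨ h * t ^ (v : ℤ) ∈ A.map f := by
    rintro _ ⟨a, ha, g, hg, rfl⟩ v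
    rw [mul_assoc]
    rcases hg.mul_zpow ht v with h | ⟨y, hy, h⟩
    · exact Or.inl ⟨a, ha, _, h, rfl⟩
    · rw [h, ← map_mul]
      exact Or.inr ⟨_, A.mul_mem ha (by simpa using hy), rfl⟩
  have hcob : ∀ s : G, ∃ F : Set G, F.Finite ∧
      ∀ h, ¬(h ∈ H ↔ h * s ∈ H) → ∃ c ∈ A.map f, ∃ y ∈ F, h = c * y := by
    refine exists_finite_coboundary_subset hgen ?_
    rintro s (rfl | ⟨x, rfl⟩)
    · refine ⟨{1, s⁻¹}, Set.toFinite _, fun h hh => ?_⟩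
      by_cases h1 : h ∈ H
      · rcases hmult h h1 1 with h2 | h2
        · exact absurd (iff_of_true h1 (by simpa using h2)) hh
        · exact ⟨_, h2, s⁻¹, by simp, by simp⟩
      · by_cases h2 : h * s ∈ H
        · rcases hmult _ h2 (-1) with h3 | h3
          · exact absurd (by simpa using h3) h1
          · exact ⟨h, by simpa using h3, 1, by simp, by simp⟩
        · exact absurd (iff_of_false h1 h2) hh
    · refine ⟨∅, Set.finite_empty, fun h hh => absurd ⟨fun h1 => hmulX h h1 x, fun h1 => ?_⟩ hh⟩
      simpa [mul_assoc, ← map_mul] using hmulX _ h1 x⁻¹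
  have hpow : ∀ (u : ℤˣ) (n : ℕ), (t ^ (u : ℤ)) ^ (n + 1) ∉ A.map f := by
    rintro u n ⟨a, -, ha⟩
    exact (isBrittonReduced_zpow_pow u n).mul_ne ht hbij.1 1 a (by simp [ha])
  by_cases hA : A = ⊤
  -- With `A = ⊤` no base element outside `A` is available to move `H` off itself. But `t` then
  -- passes to the right of every base element, so outside `H` only the elements `f x * t ^ n`
  -- remain.
  · have hcover : ∀ g, g ∈ H ∨ ∃ (x : X) (n : ℕ), g = f x * t ^ n := by
      have hshift : ∀ (n : ℕ) (x : X), ∃ y, t ^ n * f x = f y * t ^ n := by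
        intro n
        induction n with
        | zero => exact fun x => ⟨x, by simp⟩
        | succ n ih =>
          intro x
          obtain ⟨y, hy⟩ := ih (φ ⟨x, hA ▸ Subgroup.mem_top x⟩)
          exact ⟨y, by rw [pow_succ, mul_assoc, ht ⟨x, hA ▸ Subgroup.mem_top x⟩, ← mul_assoc, hy,
            mul_assoc]⟩
      have hXstep : ∀ g, (g ∈ H ∨ ∃ (x : X) (n : ℕ), g = f x * t ^ n) → ∀ y : X,
          g * f y ∈ H ∨ ∃ (x : X) (n : ℕ), g * f y = f x * t ^ n := by
        rintro _ (h | ⟨x, n, rfl⟩) y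
        · exact Or.inl (hmulX _ h y)
        · obtain ⟨z, hz⟩ := hshift n y
          exact Or.inr ⟨x * z, n, by rw [mul_assoc, hz, map_mul, mul_assoc]⟩
      intro g
      induction (hgen ▸ Subgroup.mem_top g : g ∈ Subgroup.closure (insert t (Set.range f))) using
        Subgroup.closure_induction_right with
      | one => exact Or.inr ⟨1, 0, by simp⟩
      | mul_right g _ s hs ih =>
        rcases hs with rfl | ⟨y, rfl⟩
        · rcases ih with h | ⟨x, n, rfl⟩
          · rcases hmult _ h 1 with h | ⟨x, -, h⟩
            · exact Or.inl (by simpa using h)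
            · exact Or.inr ⟨x, 0, by simpa using h.symm⟩
          · exact Or.inr ⟨x, n + 1, by rw [mul_assoc, pow_succ]⟩
        · exact hXstep g ih y
      | mul_inv_cancel g _ s hs ih =>
        rcases hs with rfl | ⟨y, rfl⟩
        · rcases ih with h | ⟨x, n, rfl⟩
          · rcases hmult _ h (-1) with h | ⟨x, -, h⟩
            · exact Or.inl (by simpa using h)
            · exact Or.inr ⟨x, 0, by simpa using h.symm⟩
          · cases n with
            | zero =>
              exact Or.inl ⟨x, hA ▸ Subgroup.mem_top x, _, isBrittonReduced_zpow_pow (-1) 0,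
                by simp⟩
            | succ n => exact Or.inr ⟨x, n, by rw [pow_succ, mul_assoc, mul_inv_cancel_right]⟩
        · rw [← map_inv]
          exact hXstep g ih y⁻¹
    -- The half-space is the complement: the inverse of `f x * t ^ n`, multiplied by `t⁻¹` on the
    -- left, is `t ^ (-(n + 1)) * f x⁻¹`, which begins with `t⁻¹`.
    refine ⟨Hᶜ, (t⁻¹ * ·⁻¹), t⁻¹, fun s => ?_, Or.inr fun _ => rfl, fun g hg => ?_,
      exists_mem_forall_ne_mul (g := t) (y := 1) (fun n => by simpa using hpow 1 n) ?_⟩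
    · obtain ⟨F, hF, h⟩ := hcob s
      exact ⟨F, hF, fun g hg => h g fun hg' => hg (not_congr hg')⟩
    · obtain ⟨x, n, rfl⟩ := (hcover g).resolve_left hg
      refine not_not.2 ⟨1, A.one_mem, _, (isBrittonReduced_zpow_pow (-1) n).mul_right x⁻¹, ?_⟩
      simp [pow_succ', mul_assoc]
    · rintro n ⟨a, -, g, hg, h⟩
      rw [mul_one] at h
      cases n with
      | zero => exact hg.mul_ne ht hbij.1 a 1 (by simpa using h.symm)
      | succ n =>
        have := (hg.eq_and_mem_of_mul_eq ht hbij.1 (isBrittonReduced_zpow_pow 1 n)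
          (x := a) (y := 1) (by simpa using h.symm)).1
        exact absurd this (by decide)
  · obtain ⟨x, hx⟩ : ∃ x, x ∉ A := by
      by_contra! h
      exact hA ((Subgroup.eq_top_iff' A).2 h)
    -- Translation by `f x` with `x ∉ A` moves the head of a word out of `A`, hence out of the coset
    -- that defines `H`.
    refine ⟨H, (f x * ·), f x, hcob, Or.inl fun _ => rfl, ?_,
      exists_mem_forall_ne_mul (g := t⁻¹) (y := t⁻¹) (fun n => by simpa using hpow (-1) n)
        fun n => ⟨1, A.one_mem, _, isBrittonReduced_zpow_pow (-1) n, by simp [pow_succ]⟩⟩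
    rintro _ ⟨a, ha, g, hg, rfl⟩ ⟨b, hb, g', hg', h⟩
    replace h : f (x * a) * g = f b * g' := by rw [map_mul, mul_assoc]; exact h
    have := (hg.eq_and_mem_of_mul_eq ht hbij.1 hg' h).2
    rw [neg_neg, toSubgroup_one, A.mul_mem_cancel_right hb, A.inv_mem_iff,
      A.mul_mem_cancel_right ha] at this
    exact hx this

end HNN

/-! ### Proof of the theorem -/

theorem SplitsOver.hasHalfspaceOver {G : Type*} [Group G] {C : Subgroup G} (h : SplitsOver C) :
    HasHalfspaceOver C := by
  rcases h with ⟨A, B, h, hbij⟩ | ⟨A, hCA, D, φ, t, ht, hbij⟩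
  · exact hasHalfspaceOver_of_bijective_pushoutI h
      (fun i a => Monoid.PushoutI.lift_of (φ := fun i => Subgroup.inclusion (h i).le)
        (fun i => (cond i A B).subtype) C.subtype (fun _ => rfl) a)
      (fun c => Monoid.PushoutI.lift_base (φ := fun i => Subgroup.inclusion (h i).le)
        (fun i => (cond i A B).subtype) C.subtype (fun _ => rfl) c) hbij
  · have := hasHalfspaceOver_of_bijective_hnnExtension_lift ht hbij
    rwa [Subgroup.map_subgroupOf_eq_of_le hCA] at this

theorem theorem5p5 {G : Type*} [Group G] [Group.FG G] (C : Subgroup G) (hsplit : SplitsOver C)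
    (hC : C.FG) (hqi : IsQuasiIsometricallyEmbedded C) (d : ℕ) (hd : 0 < d)
    (hgrowth : HasPolynomialGrowth C d) (S : Set G) (hS : IsFiniteGeneratingSet S) :
    HasPolynomialRetainingProperty (SimpleGraph.mulCayley S) (d - 1) := by
  obtain ⟨H, φ, a, hcob, hφ, hφH, hfar⟩ := hsplit.hasHalfspaceOver
  obtain ⟨c, hc⟩ := hqi.exists_ncard_ball_le hgrowth hS
  obtain ⟨d, rfl⟩ := Nat.exists_eq_add_one_of_ne_zero hd.ne'
  refine hasPolynomialRetainingProperty_of_halfspace hS (fun s _ => hcob s) (φ := φ)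
    (fun x _ y _ hxy => ?_) hφH (k := (mulCayley S).dist 1 a) (fun v => ?_) hfar hc
  · rcases hφ with hφ | hφ <;> simpa [hφ] using hxy
  · rcases hφ with hφ | hφ
    · rw [hφ, add_comm]
      exact mulCayley_dist_one_mul_le hS.2 a v
    · rw [hφ, add_comm, ← mulCayley_dist_one_inv hS.2 v]
      exact mulCayley_dist_one_mul_le hS.2 a v⁻¹
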